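/- All graphs are finite, simple and undirected. A fractional perfect matching of a graph $G$ is a function $f:E(G)\to[0,1]$ such that for every vertex $v$ the values of $f$ on the edges incident with $v$ sum to $1$. The fractional matching preclusion number $fmp(G)$ is the minimum size of a set $F\subseteq E(G)$ such that $G-F$ has no fractional perfect matching. Let $s(n,k)$ be the minimum number of edges of a graph with $n$ vertices and $fmp(G)=k$. **Theorem.** Let $n,k,\ell,r$ be non-negative integers with $n=\ell(k+1)+r$, $0\le r\le k$ and $6\le k\le n-1$. Then graphs with $n$ vertices and fractional matching preclusion number $k$ exist, and the following hold. (1) $s(n,k)=\dfrac{nk}{2}$ if one of the following holds: (a) $r=0$; (b) $r\ge 1$ and $k+r$ is odd; (c) $r\ge 1$, $k+r$ is even, $k$ is even and $\ell\ge 2$. (2) $s(n,k)=\dfrac{nk+1}{2}$ if $r\ge 1$, $k+r$ is even, $k$ is odd and $\ell\ge 2$. (3) $\left\lceil\dfrac{nk}{2}\right\rceil\le s(n,k)\le\dfrac{(n-1)(k+2)}{2}$ if $r\ge 1$, $k+r$ is even, $\ell=1$ and $k\le n-2$. -/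

import Mathlib

namespace FMP

variable {V : Type*} [Fintype V]

open Classical in
/-- `f` is a fractional matching of `G`: it assigns to each edge a number in `[0, 1]` so that at
each vertex the values on the incident edges sum to at most `1`. Values of `f` on pairs that are
not edges of `G` play no role. -/
def IsFractionalMatching (G : SimpleGraph V) (f : Sym2 V → ℝ) : Prop :=
  (∀ e ∈ G.edgeSet, 0 ≤ f e ∧ f e ≤ 1) ∧ ∀ v : V, ∑ e ∈ G.incidenceFinset v, f e ≤ 1

open Classical in
/-- A fractional matching is perfect if the sum at each vertex is exactly `1`. -/
def IsFractionalPerfectMatching (G : SimpleGraph V) (f : Sym2 V → ℝ) : Prop :=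
  IsFractionalMatching G f ∧ ∀ v : V, ∑ e ∈ G.incidenceFinset v, f e = 1

/-- `F` is a fractional matching preclusion set of `G`: a set of edges of `G` whose deletion
leaves a graph without fractional perfect matchings. -/
def IsFMPSet (G : SimpleGraph V) (F : Finset (Sym2 V)) : Prop :=
  (F : Set (Sym2 V)) ⊆ G.edgeSet ∧
    ¬ ∃ f : Sym2 V → ℝ, IsFractionalPerfectMatching (G.deleteEdges (F : Set (Sym2 V))) f

/-- The fractional matching preclusion number: the minimum size of a fractional matching
preclusion set. The minimum is over a nonempty set as soon as `V` is nonempty. -/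
noncomputable def fmp (G : SimpleGraph V) : ℕ :=
  sInf {m : ℕ | ∃ F : Finset (Sym2 V), IsFMPSet G F ∧ F.card = m}

theorem exists_isFMPSet [Nonempty V] (G : SimpleGraph V) :
    ∃ F : Finset (Sym2 V), IsFMPSet G F := by
  classical
  refine ⟨G.edgeFinset, by simp, ?_⟩
  rintro ⟨f, -, hf⟩
  have h := hf (Classical.arbitrary V)
  rw [Finset.sum_eq_zero] at h
  · exact zero_ne_one h
  · intro e he
    rw [SimpleGraph.mem_incidenceFinset] at he
    have := he.1
    simp at this

/-- The numbers of edges of the graphs of order `n` with fractional matching preclusion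
number `k`. -/
def sizes (n k : ℕ) : Set ℕ :=
  {m : ℕ | ∃ G : SimpleGraph (Fin n), fmp G = k ∧ G.edgeSet.ncard = m}

/-- The minimum number of edges of a graph of order `n` with fractional matching preclusion
number `k`; meaningful when `sizes n k` is nonempty. -/
noncomputable def minSize (n k : ℕ) : ℕ :=
  sInf (sizes n k)

end FMP

namespace FMP

open Finset Classical

/-! Lower bound: deleting all edges at a vertex destroys every fractional perfect matching, so `fmp`
is at most the minimum degree and `n * k ≤ 2 * m` for every size `m`.

Upper bound: a permutation moving each vertex to a neighbour gives a fractional perfect matching, so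
a `Robust` graph has `fmp` at least `k`. Deleting one edge lowers `fmp` by at most one, so some
spanning subgraph attains `k` exactly, with no more edges.

It remains to find sparse robust graphs. For even order, take `k` disjoint perfect matchings: fewer
than `k` deletions leave one intact. For odd order, use a complete graph, or a nearly complete cone,
plus a disjoint regular piece of even order; if there is no room for that piece, use a cone over a
regular graph of order `n - 1`. Robustness of the dense graphs and cones comes from Hall's theorem
(`exists_deficient_of_not_exists_perm`) and counting deleted edges. -/

theorem ncard_edgeSet_comap_le {V W : Type*} [Finite W] (D : SimpleGraph W)
    {f : V → W} (hf : Function.Injective f) :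
    (D.comap f).edgeSet.ncard ≤ D.edgeSet.ncard := by
  refine Set.ncard_le_ncard_of_injOn (Sym2.map f) ?_ (Sym2.map.injective hf).injOn
    (Set.toFinite _)
  intro e
  induction e with
  | _ a b => simp

/-- After deletion of fewer than `k` edges, some permutation of the vertices still moves every
vertex to a neighbour. -/
def Robust {V : Type*} (G : SimpleGraph V) (k : ℕ) : Prop :=
  ∀ D : SimpleGraph V, D.edgeSet.ncard < k → ∃ σ : Equiv.Perm V, ∀ v, (G \ D).Adj v (σ v)

theorem Robust.comap {V W : Type*} [Finite W] {G : SimpleGraph V} {k : ℕ} (h : Robust G k) (e : W ≃ V) :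
    Robust (G.comap e) k := by
  intro D hD
  obtain ⟨σ, hσ⟩ := h (D.comap e.symm)
    ((ncard_edgeSet_comap_le D e.symm.injective).trans_lt hD)
  refine ⟨(e.trans σ).trans e.symm, fun v => ?_⟩
  simpa using hσ (e v)

/-! ### Permutations, fractional matchings and bounds on `fmp` -/

section

variable {V W : Type*} [Fintype V] [Fintype W]

/-- The neighbours of a vertex, as a finset. -/
noncomputable def nbrs (G : SimpleGraph V) (v : V) : Finset V := univ.filter (G.Adj v)

@[simp]
theorem mem_nbrs {G : SimpleGraph V} {v w : V} : w ∈ nbrs G v ↔ G.Adj v w := by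
  simp [nbrs]

theorem card_nbrs (G : SimpleGraph V) (v : V) : #(nbrs G v) = G.degree v := by
  rw [← SimpleGraph.card_neighborFinset_eq_degree]
  congr 1
  ext w
  simp

theorem sum_card_nbrs (G : SimpleGraph V) : ∑ v, #(nbrs G v) = 2 * G.edgeSet.ncard := by
  simp_rw [card_nbrs]
  rw [SimpleGraph.sum_degrees_eq_twice_card_edges, ← SimpleGraph.coe_edgeFinset,
    Set.ncard_coe_finset]

theorem card_nbrs_le_ncard (G : SimpleGraph V) (v : V) : #(nbrs G v) ≤ G.edgeSet.ncard := by
  rw [card_nbrs, ← SimpleGraph.card_incidenceFinset_eq_degree, ← SimpleGraph.coe_edgeFinset,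
    Set.ncard_coe_finset]
  exact card_le_card (SimpleGraph.incidenceFinset_subset G v)

theorem exists_isFractionalPerfectMatching {G : SimpleGraph V} (σ : Equiv.Perm V)
    (hσ : ∀ v, G.Adj v (σ v)) : ∃ f, IsFractionalPerfectMatching G f := by
  -- Each vertex `v` puts weight 1/2 on the edge from `v` to `σ v`; a 2-cycle thus gives its edge
  -- weight 1. The sum at `u` receives one half from `u` and one from `σ.symm u`.
  let f : Sym2 V → ℝ := fun e => (#{v | s(v, σ v) = e} : ℝ) / 2
  have hsum : ∀ u, ∑ e ∈ G.incidenceFinset u, f e = 1 := by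
    intro u
    have h1 : #({v | s(v, σ v) ∈ G.incidenceFinset u} : Finset V) =
        ∑ e ∈ G.incidenceFinset u, #{v | s(v, σ v) = e} := by
      rw [card_eq_sum_card_fiberwise (f := fun v => s(v, σ v)) (t := G.incidenceFinset u)]
      · refine sum_congr rfl fun e he => ?_
        congr 1
        ext v
        simp only [mem_filter, mem_univ, true_and, and_iff_right_iff_imp]
        rintro rfl
        exact he
      · intro v hv
        simpa using hv
    have h2 : ({v | s(v, σ v) ∈ G.incidenceFinset u} : Finset V) = {u, σ.symm u} := by
      ext v
      simp only [SimpleGraph.mem_incidenceFinset, mem_filter, mem_univ, true_and, mem_insert,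
        mem_singleton, SimpleGraph.mk'_mem_incidenceSet_iff, hσ v, Equiv.eq_symm_apply]
      tauto
    have h3 : u ≠ σ.symm u := by
      intro h
      have := hσ u
      rw [Equiv.eq_symm_apply] at h
      rw [h] at this
      exact G.irrefl this
    rw [h2, card_pair h3] at h1
    simp only [f]
    rw [← sum_div, ← Nat.cast_sum, ← h1]
    norm_num
  have h0 : ∀ e, 0 ≤ f e := fun e => by positivity
  refine ⟨f, ⟨fun e he => ⟨h0 e, ?_⟩, fun v => (hsum v).le⟩, hsum⟩
  induction e with
  | _ a b =>
    rw [← hsum a]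
    refine single_le_sum (f := f) (fun e _ => h0 e) ?_
    simpa using he

theorem Robust.le_fmp [Nonempty V] {G : SimpleGraph V} {k : ℕ} (h : Robust G k) :
    k ≤ fmp G := by
  refine le_csInf ?_ ?_
  · obtain ⟨F, hF⟩ := exists_isFMPSet G
    exact ⟨_, F, hF, rfl⟩
  · rintro m ⟨F, hF, rfl⟩
    by_contra! hlt
    obtain ⟨σ, hσ⟩ := h (SimpleGraph.fromEdgeSet (F : Set (Sym2 V))) (by
      refine lt_of_le_of_lt ?_ hlt
      rw [SimpleGraph.edgeSet_fromEdgeSet, ← Set.ncard_coe_finset]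
      exact Set.ncard_le_ncard Set.sdiff_subset)
    exact hF.2 (exists_isFractionalPerfectMatching σ hσ)

theorem fmp_le_of_isFMPSet {G : SimpleGraph V} {F : Finset (Sym2 V)} (h : IsFMPSet G F) :
    fmp G ≤ #F :=
  Nat.sInf_le ⟨F, h, rfl⟩

theorem exists_isFMPSet_card_eq_fmp [Nonempty V] (G : SimpleGraph V) :
    ∃ F : Finset (Sym2 V), IsFMPSet G F ∧ #F = fmp G := by
  obtain ⟨F, hF⟩ := exists_isFMPSet G
  exact Nat.sInf_mem (s := {m : ℕ | ∃ F : Finset (Sym2 V), IsFMPSet G F ∧ #F = m}) ⟨_, F, hF, rfl⟩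

theorem fmp_le_card_nbrs (G : SimpleGraph V) (v : V) : fmp G ≤ #(nbrs G v) := by
  rw [card_nbrs, ← SimpleGraph.card_incidenceFinset_eq_degree]
  refine fmp_le_of_isFMPSet ⟨?_, ?_⟩
  · simpa using G.incidenceSet_subset v
  · rintro ⟨f, -, hf⟩
    have h := hf v
    rw [sum_eq_zero] at h
    · exact zero_ne_one h
    · intro e he
      rw [SimpleGraph.mem_incidenceFinset] at he
      have h1 := he.1
      rw [SimpleGraph.edgeSet_deleteEdges] at h1
      exact absurd (by simpa using ⟨h1.1, he.2⟩) h1.2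

theorem card_mul_fmp_le (G : SimpleGraph V) : Fintype.card V * fmp G ≤ 2 * G.edgeSet.ncard := by
  rw [← sum_card_nbrs, ← smul_eq_mul, ← card_univ]
  exact card_nsmul_le_sum _ _ _ fun v _ => fmp_le_card_nbrs G v

theorem fmp_le_fmp_deleteEdges_singleton [Nonempty V] (G : SimpleGraph V) {e : Sym2 V}
    (he : e ∈ G.edgeSet) : fmp G ≤ fmp (G.deleteEdges {e}) + 1 := by
  obtain ⟨F, hF, hc⟩ := exists_isFMPSet_card_eq_fmp (G.deleteEdges {e})
  rw [← hc]
  refine (fmp_le_of_isFMPSet (F := insert e F) ⟨?_, ?_⟩).trans (card_insert_le _ _)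
  · rw [coe_insert, Set.insert_subset_iff]
    refine ⟨he, hF.1.trans ?_⟩
    exact SimpleGraph.edgeSet_mono (SimpleGraph.deleteEdges_le _)
  · have := hF.2
    rwa [SimpleGraph.deleteEdges_deleteEdges, Set.singleton_union, ← coe_insert] at this

/-- Discrete continuity: as edges are removed one by one, `fmp` drops to 0 in steps of at most 1, so
it cannot skip `k`. -/
theorem exists_le_fmp_eq [Nonempty V] (G : SimpleGraph V) {k : ℕ} (h : k ≤ fmp G) :
    ∃ H : SimpleGraph V, fmp H = k ∧ H.edgeSet.ncard ≤ G.edgeSet.ncard := by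
  induction hm : G.edgeSet.ncard generalizing G with
  | zero =>
    refine ⟨G, le_antisymm ?_ h, hm.le⟩
    have h1 := fmp_le_card_nbrs G (Classical.arbitrary V)
    have h2 := card_nbrs_le_ncard G (Classical.arbitrary V)
    omega
  | succ m ih =>
    obtain h | h := h.eq_or_lt
    · exact ⟨G, h.symm, hm.le⟩
    · obtain ⟨e, he⟩ : G.edgeSet.Nonempty := by
        rw [← Set.ncard_pos]
        omega
      have h1 := fmp_le_fmp_deleteEdges_singleton G he
      have h2 : (G.deleteEdges {e}).edgeSet.ncard = m := by
        rw [SimpleGraph.edgeSet_deleteEdges, Set.ncard_sdiff_singleton_of_mem he, hm]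
        rfl
      obtain ⟨H, hH, hle⟩ := ih (G.deleteEdges {e}) (by omega) h2
      exact ⟨H, hH, by omega⟩

/-- A robust graph with `k` as parameter yields an upper bound on `minSize`. -/
theorem Robust.exists_mem_sizes {G : SimpleGraph V} {n k : ℕ} (h : Robust G k)
    (hn : Fintype.card V = n) (hn0 : 0 < n) : ∃ m ∈ sizes n k, m ≤ G.edgeSet.ncard := by
  have : Nonempty (Fin n) := ⟨⟨0, hn0⟩⟩
  let e : Fin n ≃ V := (Fintype.equivFinOfCardEq hn).symm
  obtain ⟨H, hH, hle⟩ := exists_le_fmp_eq _ (h.comap e).le_fmp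
  exact ⟨_, ⟨H, hH, rfl⟩, hle.trans (ncard_edgeSet_comap_le G e.injective)⟩

/-- A Hall violator `A` with neighbourhood `N` remains deficient after `A ∩ N` is removed from both
sets. Then `T = A \ N` is independent, and all its neighbours lie in the smaller set `S = N \ A`. -/
theorem exists_deficient_of_not_exists_perm {G : SimpleGraph V}
    (h : ¬ ∃ σ : Equiv.Perm V, ∀ v, G.Adj v (σ v)) :
    ∃ T S : Finset V, #S < #T ∧ Disjoint S T ∧ ∀ u ∈ T, ∀ v, G.Adj u v → v ∈ S := by
  have h1 : ¬ ∀ A : Finset V, #A ≤ #(A.biUnion (nbrs G)) := by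
    rw [all_card_le_biUnion_card_iff_exists_injective]
    rintro ⟨f, hf, hadj⟩
    exact h ⟨Equiv.ofBijective f (Finite.injective_iff_bijective.mp hf), fun v => by
      simpa using hadj v⟩
  push Not at h1
  obtain ⟨A, hA⟩ := h1
  set N := A.biUnion (nbrs G) with hN
  have hmem : ∀ v, v ∈ N ↔ ∃ u ∈ A, G.Adj u v := by simp [hN]
  refine ⟨A \ N, N \ A, ?_, ?_, ?_⟩
  · have h2 := card_sdiff_add_card_inter A N
    have h3 := card_sdiff_add_card_inter N A
    rw [inter_comm] at h3
    omega
  · exact disjoint_sdiff_sdiff.symm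
  · intro u hu v huv
    rw [mem_sdiff] at hu ⊢
    refine ⟨(hmem v).2 ⟨u, hu.1, huv⟩, fun hv => hu.2 ((hmem u).2 ⟨v, hv, huv.symm⟩)⟩

end

/-! ### Robust building blocks: matchings, disjoint unions, cones, dense graphs -/

section

variable {V W : Type*} [Fintype V] [Fintype W]

/-- The union of a family of pairwise disjoint perfect matchings, each given as a fixed-point-free
involution. -/
def unionMatchings {ι V : Type*} (m : ι → V → V) (hinv : ∀ i v, m i (m i v) = v)
    (hne : ∀ i v, m i v ≠ v) : SimpleGraph V where
  Adj u v := ∃ i, m i u = v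
  symm := ⟨by
    rintro u v ⟨i, rfl⟩
    exact ⟨i, hinv i u⟩⟩
  loopless := ⟨by
    rintro v ⟨i, hi⟩
    exact hne i v hi⟩

variable {ι : Type*} [Fintype ι] {m : ι → V → V} {hinv : ∀ i v, m i (m i v) = v}
  {hne : ∀ i v, m i v ≠ v}

theorem card_nbrs_unionMatchings (hdisj : ∀ i j v, m i v = m j v → i = j) (v : V) :
    #(nbrs (unionMatchings m hinv hne) v) = Fintype.card ι := by
  have : nbrs (unionMatchings m hinv hne) v = univ.image fun i => m i v := by
    ext w
    simp [unionMatchings]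
  rw [this, card_image_of_injective _ fun i j h => hdisj i j v h, card_univ]

theorem robust_unionMatchings (hdisj : ∀ i j v, m i v = m j v → i = j) :
    Robust (unionMatchings m hinv hne) (Fintype.card ι) := by
  intro D hD
  -- Otherwise each of the disjoint matchings contains an edge of `D`, which gives too many edges.
  obtain ⟨i, hi⟩ : ∃ i, ∀ v, ¬ D.Adj v (m i v) := by
    by_contra! hcon
    choose w hw using hcon
    refine hD.not_ge ?_
    have hinj : Function.Injective fun i => (⟨s(w i, m i (w i)), hw i⟩ : D.edgeSet) := by
      intro i j hij
      obtain ⟨h1, h2⟩ | ⟨h1, h2⟩ := Sym2.eq_iff.1 (Subtype.ext_iff.1 hij)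
      · rw [← h1] at h2
        exact hdisj i j _ h2
      · refine hdisj i j (w i) ?_
        rw [h2, h1, hinv]
    rw [← Nat.card_coe_set_eq, ← Nat.card_eq_fintype_card]
    exact Nat.card_le_card_of_injective _ hinj
  exact ⟨⟨m i, m i, hinv i, hinv i⟩, fun v => ⟨⟨i, rfl⟩, hi v⟩⟩

theorem Robust.sum {G : SimpleGraph V} {H : SimpleGraph W} {k : ℕ} (hG : Robust G k)
    (hH : Robust H k) : Robust (G ⊕g H) k := by
  intro D hD
  obtain ⟨σ, hσ⟩ := hG (D.comap Sum.inl)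
    ((ncard_edgeSet_comap_le D Sum.inl_injective).trans_lt hD)
  obtain ⟨τ, hτ⟩ := hH (D.comap Sum.inr)
    ((ncard_edgeSet_comap_le D Sum.inr_injective).trans_lt hD)
  refine ⟨Equiv.sumCongr σ τ, ?_⟩
  rintro (v | v)
  · simpa using hσ v
  · simpa using hτ v

theorem ncard_edgeSet_sum (G : SimpleGraph V) (H : SimpleGraph W) :
    (G ⊕g H).edgeSet.ncard = G.edgeSet.ncard + H.edgeSet.ncard := by
  have h := sum_card_nbrs (G ⊕g H)
  have hl : ∀ v, nbrs (G ⊕g H) (Sum.inl v) = (nbrs G v).map ⟨Sum.inl, Sum.inl_injective⟩ := by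
    intro v
    ext (w | w) <;> simp
  have hr : ∀ v, nbrs (G ⊕g H) (Sum.inr v) = (nbrs H v).map ⟨Sum.inr, Sum.inr_injective⟩ := by
    intro v
    ext (w | w) <;> simp
  rw [Fintype.sum_sum_type] at h
  simp only [hl, hr, card_map, sum_card_nbrs] at h
  omega

/-- The cone over a graph: one new vertex, adjacent to all others. -/
def cone {V : Type*} (G : SimpleGraph V) : SimpleGraph (Option V) where
  Adj
    | some u, some v => G.Adj u v
    | none, none => False
    | _, _ => True
  symm := ⟨by
    rintro (_ | u) (_ | v) <;> simp [G.adj_comm]⟩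
  loopless := ⟨by
    rintro (_ | u) <;> simp⟩

section

variable {V : Type*} {G : SimpleGraph V} {u v : V}

@[simp]
theorem cone_adj_some_some : (cone G).Adj (some u) (some v) ↔ G.Adj u v := Iff.rfl

@[simp]
theorem cone_adj_none_some : (cone G).Adj none (some v) := trivial

@[simp]
theorem cone_adj_some_none : (cone G).Adj (some v) none := trivial

end

theorem card_nbrs_cone_none (G : SimpleGraph V) : #(nbrs (cone G) none) = Fintype.card V := by
  have : nbrs (cone G) none = univ.map ⟨some, Option.some_injective V⟩ := by
    ext (_ | w) <;> simp
  rw [this, card_map, card_univ]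

theorem card_nbrs_cone_some (G : SimpleGraph V) (v : V) :
    #(nbrs (cone G) (some v)) = #(nbrs G v) + 1 := by
  have : nbrs (cone G) (some v) = insertNone (nbrs G v) := by
    ext (_ | w) <;> simp
  rw [this, card_insertNone]

theorem ncard_edgeSet_cone (G : SimpleGraph V) :
    (cone G).edgeSet.ncard = G.edgeSet.ncard + Fintype.card V := by
  have h := sum_card_nbrs (cone G)
  rw [Fintype.sum_option] at h
  simp only [card_nbrs_cone_none, card_nbrs_cone_some, sum_add_distrib,
    sum_card_nbrs, sum_const, card_univ, smul_eq_mul, mul_one] at h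
  omega

/-- The cone over a robust regular graph is robust. -/
theorem Robust.cone {G : SimpleGraph V} {k : ℕ} (h : Robust G k) (hreg : ∀ v, #(nbrs G v) = k)
    (hV : k + 1 ≤ Fintype.card V) : Robust (cone G) k := by
  intro D hD
  by_contra hcon
  obtain ⟨T, S, hST, hdisj, hN⟩ := exists_deficient_of_not_exists_perm hcon
  obtain ⟨σ, hσ⟩ := h (D.comap some)
    ((ncard_edgeSet_comap_le D (Option.some_injective V)).trans_lt hD)
  have hσ' : ∀ v, (FMP.cone G \ D).Adj (some v) (some (σ v)) := fun v => by simpa using hσ v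
  set T₀ := eraseNone T with hT₀
  set S₀ := eraseNone S with hS₀
  have hS₀S : #S₀ ≤ #S := by
    exact card_eraseNone_le S
  -- The permutation surviving on the base maps `T₀` into `S₀`, so only the apex can cause the
  -- deficiency: it lies in `T`, and `S₀`, `T₀` have equal size.
  have hle : #T₀ ≤ #S₀ := by
    rw [← card_map σ.toEmbedding]
    refine card_le_card fun w hw => ?_
    rw [mem_map] at hw
    obtain ⟨v, hv, rfl⟩ := hw
    rw [hT₀, mem_eraseNone] at hv
    rw [hS₀, mem_eraseNone]
    exact hN _ hv _ (hσ' v)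
  have hT : none ∈ T := by
    by_contra hno
    have : #T₀ = #T := by
      rw [hT₀, card_eraseNone_of_not_mem hno]
    omega
  have hTc : #T₀ + 1 = #T := by
    rw [hT₀, card_eraseNone_of_mem hT]
    have : 0 < #T := card_pos.2 ⟨_, hT⟩
    omega
  have hdisj₀ : Disjoint S₀ T₀ := by
    rw [disjoint_left] at hdisj ⊢
    intro v hv hv'
    exact hdisj (mem_eraseNone.1 hv) (mem_eraseNone.1 hv')
  have hS : #S₀ = #T₀ := by omega
  have hDnone : ∀ v ∉ S₀, D.Adj none (some v) := by
    intro v hv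
    by_contra hv'
    refine hv (mem_eraseNone.2 (hN _ hT _ ?_))
    simpa using hv'
  have hnone : Fintype.card V ≤ #(nbrs D none) + #T₀ := by
    have h1 : #(S₀ᶜ) ≤ #(nbrs D none) := by
      rw [← card_map ⟨some, Option.some_injective V⟩]
      refine card_le_card fun w hw => ?_
      simp only [mem_map, mem_compl, Function.Embedding.coeFn_mk] at hw
      obtain ⟨v, hv, rfl⟩ := hw
      simpa using hDnone v hv
    rw [card_compl] at h1
    omega
  have hdT : ∀ v ∈ T₀, k + 1 ≤ #(nbrs D (some v)) + #T₀ := by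
    intro v hv
    have hsub : insertNone (nbrs G v \ S₀) ⊆ nbrs D (some v) := by
      rintro (_ | w) hw
      · simpa using (hDnone v (disjoint_right.1 hdisj₀ hv)).symm
      · rw [some_mem_insertNone, mem_sdiff, mem_nbrs] at hw
        rw [mem_nbrs]
        by_contra hD'
        refine hw.2 (mem_eraseNone.2 (hN _ (mem_eraseNone.1 hv) _ ?_))
        simpa using ⟨hw.1, hD'⟩
    have h1 := card_le_card hsub
    rw [card_insertNone] at h1
    have h2 := le_card_sdiff S₀ (nbrs G v)
    rw [hreg] at h2
    omega
  have hd1 : ∀ v ∉ S₀, 1 ≤ #(nbrs D (some v)) := by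
    intro v hv
    exact card_pos.2 ⟨none, by simpa using (hDnone v hv).symm⟩
  have hsum := sum_card_nbrs D
  rw [Fintype.sum_option] at hsum
  -- Every base vertex outside `S₀` has lost its edge to the apex; one in `T₀` has also lost its
  -- base edges leaving `S₀`.
  have hsplit : #T₀ * max 1 (k + 1 - #T₀) + (Fintype.card V - #T₀ - #T₀) * 1 ≤
      ∑ v, #(nbrs D (some v)) := by
    have hU : T₀ ∪ (S₀ ∪ T₀)ᶜ ⊆ univ := subset_univ _
    have hd : Disjoint T₀ (S₀ ∪ T₀)ᶜ := by
      rw [disjoint_left]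
      intro v hv hv'
      simp [hv] at hv'
    refine le_trans ?_ (sum_le_sum_of_subset hU)
    rw [sum_union hd]
    refine add_le_add ?_ ?_
    · refine card_nsmul_le_sum _ _ _ fun v hv => ?_
      have h1 := hd1 v (disjoint_right.1 hdisj₀ hv)
      have h2 := hdT v hv
      omega
    · have : #((S₀ ∪ T₀)ᶜ) = Fintype.card V - #T₀ - #T₀ := by
        rw [card_compl, card_union_of_disjoint hdisj₀, hS]
        omega
      rw [← this]
      refine card_nsmul_le_sum _ _ _ fun v hv => hd1 v ?_
      simp only [mem_compl, mem_union, not_or] at hv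
      exact hv.1
  have h2s : #T₀ + #T₀ ≤ Fintype.card V := by
    have := card_le_univ (S₀ ∪ T₀)
    rw [card_union_of_disjoint hdisj₀] at this
    omega
  have hdeg := card_nbrs_le_ncard D none
  -- The apex has lost at least `card V - #T₀` edges, fewer than `k`, while `card V` exceeds `k`.
  have hs2 : 2 ≤ #T₀ := by omega
  generalize #T₀ = s at *
  obtain hks | hks := le_total k s
  · have h3 : s * 1 ≤ s * max 1 (k + 1 - s) := Nat.mul_le_mul_left _ (le_max_left _ _)
    omega
  · obtain ⟨d, rfl⟩ := Nat.exists_eq_add_of_le hks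
    have h3 : s * (d + 1) ≤ s * max 1 (s + d + 1 - s) :=
      Nat.mul_le_mul_left _ (le_max_of_le_right (by omega))
    have h4 : 2 * d ≤ s * d := Nat.mul_le_mul_right _ hs2
    rw [mul_add] at h3
    obtain _ | _ | d := d
    · omega
    · omega
    · omega

/-- The count for `robust_of_dense`, with `#S = s`, `#T = s + 1 + a`, `k = s + b` and `x` vertices
outside both sets. The bound `6 + c` excludes real exceptions: for `c = 0`, `k = 4`, deleting a
triangle from the complete graph on 5 vertices leaves three independent vertices with two
neighbours. -/
theorem two_mul_le_of_dense {s a b c x : ℕ} (hs : 0 < s) (hc : c ≤ 1) (hk : 6 + c ≤ s + b)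
    (hb : b + c = x + s + a) : 2 * (s + b) ≤ (s + 1 + a) * b + x * (s + 1 + a - c) := by
  have hu : s + a ≤ 3 ∨ 4 ≤ s + a := by omega
  interval_cases c
  · obtain rfl : b = x + s + a := by omega
    rw [Nat.sub_zero]
    obtain hu | hu := hu
    · have h1 : s ≤ 3 := by omega
      have h2 : a ≤ 2 := by omega
      interval_cases s <;> interval_cases a <;> omega
    · nlinarith [Nat.zero_le (x * s), Nat.zero_le (x * a)]
  · have h3 : s + 1 + a - 1 = s + a := by omega
    obtain ⟨d, hd⟩ : ∃ d, s + a = d + 1 := ⟨s + a - 1, by omega⟩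
    obtain rfl : b = x + d := by omega
    rw [h3, hd, show s + 1 + a = d + 2 by omega]
    obtain hu | hu := hu
    · have h1 : s ≤ 3 := by omega
      have h2 : d ≤ 2 := by omega
      interval_cases d <;> omega
    · have h4 : s ≤ d + 1 := by omega
      have h5 : 3 ≤ d := by omega
      nlinarith [Nat.zero_le (x * d), mul_le_mul' h5 h5]

/-- Graphs of sufficiently large order in which every vertex is adjacent to all others, or to all
but one of the others, are robust. -/
theorem robust_of_dense {G : SimpleGraph V} {k c : ℕ} (hV : Fintype.card V = k + 1 + c)
    (hc : c ≤ 1) (hk : 6 + c ≤ k) (hdeg : ∀ v, k ≤ #(nbrs G v)) : Robust G k := by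
  intro D hD
  by_contra hcon
  obtain ⟨T, S, hST, hdisj, hN⟩ := exists_deficient_of_not_exists_perm hcon
  have hadj : ∀ u ∈ T, ∀ v ∉ S, G.Adj u v → D.Adj u v := by
    intro u hu v hv huv
    by_contra hD'
    exact hv (hN u hu v ⟨huv, hD'⟩)
  have hT : ∀ v ∈ T, k ≤ #(nbrs D v) + #S := by
    intro v hv
    have h1 : nbrs G v ⊆ nbrs D v ∪ S := by
      intro w hw
      by_cases hwS : w ∈ S
      · exact mem_union_right _ hwS
      · exact mem_union_left _ (mem_nbrs.2 (hadj v hv w hwS (mem_nbrs.1 hw)))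
    exact (hdeg v).trans ((card_le_card h1).trans (card_union_le _ _))
  -- Such a `v` has at most `c` non-neighbours in `G` besides itself, and its edges to `T` all lie
  -- in `D`.
  have hR : ∀ v ∈ (S ∪ T)ᶜ, #T ≤ #(nbrs D v) + c := by
    intro v hv
    simp only [mem_compl, mem_union, not_or] at hv
    have h1 : T \ nbrs D v ⊆ ((nbrs G v)ᶜ).erase v := by
      intro w hw
      rw [mem_sdiff, mem_nbrs] at hw
      rw [mem_erase, mem_compl, mem_nbrs]
      refine ⟨fun h => hv.2 (h ▸ hw.1), fun h => hw.2 (hadj w hw.1 v hv.1 h.symm).symm⟩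
    have h2 := card_le_card h1
    rw [card_erase_of_mem (by simp), card_compl] at h2
    have h3 := le_card_sdiff (nbrs D v) T
    have h4 := hdeg v
    omega
  have hcard : #((S ∪ T)ᶜ) + #S + #T = k + 1 + c := by
    rw [card_compl, card_union_of_disjoint hdisj, hV]
    have := card_le_univ (S ∪ T)
    rw [card_union_of_disjoint hdisj, hV] at this
    omega
  have hsum : #T * (k - #S) + #((S ∪ T)ᶜ) * (#T - c) ≤ 2 * D.edgeSet.ncard := by
    rw [← sum_card_nbrs]
    have hd : Disjoint T (S ∪ T)ᶜ := by
      rw [disjoint_left]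
      intro v hv hv'
      simp [hv] at hv'
    refine le_trans ?_ (sum_le_sum_of_subset (subset_univ (T ∪ (S ∪ T)ᶜ)))
    rw [sum_union hd]
    refine add_le_add ?_ ?_
    · refine card_nsmul_le_sum _ _ _ fun v hv => ?_
      have := hT v hv
      omega
    · refine card_nsmul_le_sum _ _ _ fun v hv => ?_
      have := hR v hv
      omega
  have hS0 : 0 < #S := by
    obtain ⟨v, hv⟩ : T.Nonempty := card_pos.1 (by omega)
    have h1 := hT v hv
    have h2 := card_nbrs_le_ncard D v
    omega
  generalize #T = t at *
  generalize #S = s at *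
  generalize #((S ∪ T)ᶜ) = x at *
  have hsk : s ≤ k := by omega
  obtain ⟨a, rfl⟩ := Nat.exists_eq_add_of_le (Nat.succ_le_of_lt hST)
  obtain ⟨b, rfl⟩ := Nat.exists_eq_add_of_le hsk
  rw [Nat.add_sub_cancel_left] at hsum
  have := two_mul_le_of_dense (s := s) (a := a) (b := b) (x := x) hS0 hc hk (by omega)
  rw [Nat.succ_eq_add_one] at hsum
  omega

end

/-! ### The 1-factorization of a complete graph of even order -/

section

variable {R : Type*} [CommRing R]

/-- The perfect matching of colour `i` in the standard 1-factorization of the complete graph on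
`R` and one further vertex, where `h` is the inverse of `2`: two elements of `R` are matched if
their sum is `i`. -/
noncomputable def colourMatching (h i : R) : Option R → Option R
  | none => some (h * i)
  -- `h * i` is the fixed point of `x ↦ i - x`, so it is paired with the extra point.
  | some x => if x = h * i then none else some (i - x)

variable {h : R}

theorem colourMatching_colourMatching (hh : 2 * h = 1) (i : R) (v : Option R) :
    colourMatching h i (colourMatching h i v) = v := by
  obtain _ | x := v
  · simp [colourMatching]
  · by_cases hx : x = h * i
    · simp [colourMatching, hx]
    · have : i - x ≠ h * i := fun h' => hx (by linear_combination -h' - i * hh)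
      simp [colourMatching, hx, this]

theorem colourMatching_ne (hh : 2 * h = 1) (i : R) (v : Option R) : colourMatching h i v ≠ v := by
  obtain _ | x := v
  · simp [colourMatching]
  · by_cases hx : x = h * i
    · simp [colourMatching, hx]
    · have : i - x ≠ x := fun h' => hx (by linear_combination -h * h' - x * hh)
      simp [colourMatching, hx, this]

theorem eq_of_colourMatching_eq (hh : 2 * h = 1) {i j : R} {v : Option R}
    (hij : colourMatching h i v = colourMatching h j v) : i = j := by
  have hinj : h * i = h * j → i = j := fun h' => by linear_combination 2 * h' + (j - i) * hh
  obtain _ | x := v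
  · exact hinj (by simpa [colourMatching] using hij)
  · by_cases hi : x = h * i <;> by_cases hj : x = h * j
    · exact hinj (hi.symm.trans hj)
    · simp [colourMatching, hi] at hij
      simp_all
    · simp [colourMatching, hj] at hij
      simp_all
    · simpa [colourMatching, hi, hj] using hij

end

theorem two_mul_ncard_of_regular {V : Type*} [Fintype V] {G : SimpleGraph V} {k : ℕ}
    (h : ∀ v, #(nbrs G v) = k) : 2 * G.edgeSet.ncard = Fintype.card V * k := by
  rw [← sum_card_nbrs, sum_congr rfl fun v _ => h v, sum_const, card_univ, smul_eq_mul]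

theorem exists_robust_regular {n k : ℕ} (hn : Even n) (hk : k < n) :
    ∃ (V : Type) (_ : Fintype V) (G : SimpleGraph V),
      Fintype.card V = n ∧ Robust G k ∧ ∀ v, #(nbrs G v) = k := by
  obtain ⟨j, rfl⟩ : ∃ j, n = 2 * j + 2 := by
    obtain ⟨i, rfl⟩ := hn
    exact ⟨i - 1, by omega⟩
  -- `j + 1` is the inverse of 2 modulo `2 * j + 1`.
  have hh : (2 : ZMod (2 * j + 1)) * (j + 1 : ℕ) = 1 := by
    have := ZMod.natCast_self (2 * j + 1)
    push_cast at this ⊢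
    linear_combination this
  obtain ⟨c⟩ : Nonempty (Fin k ↪ ZMod (2 * j + 1)) :=
    Function.Embedding.nonempty_of_card_le (by rw [ZMod.card, Fintype.card_fin]; omega)
  have hdisj : ∀ (i i' : Fin k) v, colourMatching ((j + 1 : ℕ) : ZMod (2 * j + 1)) (c i) v =
      colourMatching ((j + 1 : ℕ) : ZMod (2 * j + 1)) (c i') v → i = i' :=
    fun i i' v hv => c.injective (eq_of_colourMatching_eq hh hv)
  have hinv := fun i : Fin k => colourMatching_colourMatching hh (c i)
  have hne := fun i : Fin k => colourMatching_ne hh (c i)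
  refine ⟨Option (ZMod (2 * j + 1)), inferInstance, unionMatchings _ hinv hne, ?_, ?_, ?_⟩
  · rw [Fintype.card_option, ZMod.card]
  · have h := robust_unionMatchings (hinv := hinv) (hne := hne) hdisj
    rwa [Fintype.card_fin] at h
  · intro v
    rw [card_nbrs_unionMatchings hdisj, Fintype.card_fin]

/-! ### Upper bounds by the parities of `n` and `k` -/

theorem exists_mem_sizes_of_even {n k : ℕ} (hn : Even n) (hk : k < n) :
    ∃ m ∈ sizes n k, 2 * m ≤ n * k := by
  obtain ⟨V, _, G, hV, hG, hreg⟩ := exists_robust_regular hn hk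
  obtain ⟨m, hm, hle⟩ := hG.exists_mem_sizes hV (by omega)
  have := two_mul_ncard_of_regular hreg
  rw [hV] at this
  exact ⟨m, hm, by omega⟩

theorem card_nbrs_top {k : ℕ} (v : Fin (k + 1)) :
    #(nbrs (⊤ : SimpleGraph (Fin (k + 1))) v) = k := by
  have : nbrs (⊤ : SimpleGraph (Fin (k + 1))) v = univ.erase v := by
    ext w
    simp [eq_comm]
  rw [this, card_erase_of_mem (mem_univ v), card_univ, Fintype.card_fin, Nat.add_sub_cancel]

theorem robust_top {k : ℕ} (hk : 6 ≤ k) : Robust (⊤ : SimpleGraph (Fin (k + 1))) k :=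
  robust_of_dense (c := 0) (by simp) (by simp) hk fun v => (card_nbrs_top v).ge

theorem two_mul_ncard_edgeSet_top (k : ℕ) :
    2 * (⊤ : SimpleGraph (Fin (k + 1))).edgeSet.ncard = (k + 1) * k := by
  rw [two_mul_ncard_of_regular card_nbrs_top, Fintype.card_fin]

theorem exists_mem_sizes_succ {k : ℕ} (hk : 6 ≤ k) :
    ∃ m ∈ sizes (k + 1) k, 2 * m ≤ (k + 1) * k := by
  obtain ⟨m, hm, hle⟩ := (robust_top hk).exists_mem_sizes (Fintype.card_fin _) k.succ_pos
  have := two_mul_ncard_edgeSet_top k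
  exact ⟨m, hm, by omega⟩

/-- The disjoint union of a robust graph and a regular robust graph of even order. -/
theorem Robust.exists_mem_sizes_add {V : Type} [Fintype V] {G : SimpleGraph V} {n k : ℕ}
    (hG : Robust G k) (hn : Even n) (hk : k < n) :
    ∃ m ∈ sizes (Fintype.card V + n) k, 2 * m ≤ 2 * G.edgeSet.ncard + n * k := by
  obtain ⟨W, _, H, hW, hH, hreg⟩ := exists_robust_regular hn hk
  obtain ⟨m, hm, hle⟩ := (hG.sum hH).exists_mem_sizes
    (n := Fintype.card V + n) (by rw [Fintype.card_sum, hW]) (by omega)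
  have h1 := two_mul_ncard_of_regular hreg
  have h2 := ncard_edgeSet_sum G H
  rw [hW] at h1
  exact ⟨m, hm, by omega⟩

theorem exists_mem_sizes_of_odd_of_even {n k : ℕ} (hk6 : 6 ≤ k) (hn : Odd n) (hk : Even k)
    (hkn : n = k + 1 ∨ 2 * k + 2 ≤ n) : ∃ m ∈ sizes n k, 2 * m ≤ n * k := by
  obtain rfl | hkn := hkn
  · exact exists_mem_sizes_succ hk6
  · obtain ⟨j, rfl⟩ := Nat.exists_eq_add_of_le (show k + 1 ≤ n by omega)
    obtain ⟨m, hm, hle⟩ := (robust_top hk6).exists_mem_sizes_add (n := j)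
      (by grind) (by omega)
    rw [Fintype.card_fin] at hm
    have := two_mul_ncard_edgeSet_top k
    exact ⟨m, hm, by rw [add_mul]; omega⟩

/-- No graph of odd order is regular of odd degree. The cone over a `(k - 1)`-regular graph on `k +
1` vertices has apex degree `k + 1` and all other degrees `k`, so the degree sum exceeds `n * k` by
only 1; the other `n - k - 2` vertices form a `k`-regular piece of even order. -/
theorem exists_mem_sizes_of_odd_of_odd {n k : ℕ} (hk6 : 6 ≤ k) (hn : Odd n) (hk : Odd k)
    (hkn : 2 * k + 3 ≤ n) : ∃ m ∈ sizes n k, 2 * m ≤ n * k + 1 := by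
  obtain ⟨V, _, H, hV, -, hreg⟩ :=
    exists_robust_regular (n := k + 1) (k := k - 1) hk.add_one (by omega)
  have hcard : Fintype.card (Option V) = k + 2 := by rw [Fintype.card_option, hV]
  have hG : Robust (cone H) k := by
    refine robust_of_dense (c := 1) hcard le_rfl (by grind) ?_
    rintro (_ | v)
    · rw [card_nbrs_cone_none, hV]
      omega
    · rw [card_nbrs_cone_some, hreg]
      omega
  obtain ⟨j, rfl⟩ := Nat.exists_eq_add_of_le (show k + 2 ≤ n by omega)
  obtain ⟨m, hm, hle⟩ := hG.exists_mem_sizes_add (n := j) (by grind) (by omega)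
  rw [hcard] at hm
  have h1 := two_mul_ncard_of_regular hreg
  rw [hV] at h1
  have h2 := ncard_edgeSet_cone H
  rw [hV] at h2
  refine ⟨m, hm, ?_⟩
  obtain ⟨i, rfl⟩ : ∃ i, k = i + 1 := ⟨k - 1, by omega⟩
  rw [Nat.add_sub_cancel] at h1
  nlinarith

theorem exists_mem_sizes_of_odd {n k : ℕ} (hn : Odd n) (hkn : k + 2 ≤ n) :
    ∃ m ∈ sizes n k, 2 * m ≤ (n - 1) * (k + 2) := by
  obtain ⟨V, _, H, hV, hH, hreg⟩ :=
    exists_robust_regular (n := n - 1) (k := k) (by grind) (by omega)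
  obtain ⟨m, hm, hle⟩ := (hH.cone hreg (by omega)).exists_mem_sizes (n := n)
    (by rw [Fintype.card_option, hV]; omega) (by omega)
  have h1 := two_mul_ncard_of_regular hreg
  have h2 := ncard_edgeSet_cone H
  rw [hV] at h1 h2
  exact ⟨m, hm, by rw [mul_add]; omega⟩

theorem mul_le_two_mul_of_mem_sizes {n k m : ℕ} (h : m ∈ sizes n k) : n * k ≤ 2 * m := by
  obtain ⟨G, rfl, rfl⟩ := h
  simpa using card_mul_fmp_le G

theorem minSize_bounds {n k m b : ℕ} (hm : m ∈ sizes n k) (hb : 2 * m ≤ b) :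
    n * k ≤ 2 * minSize n k ∧ 2 * minSize n k ≤ b := by
  refine ⟨mul_le_two_mul_of_mem_sizes (Nat.sInf_mem ⟨m, hm⟩), ?_⟩
  have : minSize n k ≤ m := Nat.sInf_le hm
  omega

end FMP

theorem theorem3p1 (n k l r : ℕ) (hn : n = l * (k + 1) + r) (hr : r ≤ k)
    (hk : 6 ≤ k) (hkn : k + 1 ≤ n) :
    (FMP.sizes n k).Nonempty ∧
    ((r = 0 ∨ (1 ≤ r ∧ Odd (k + r)) ∨ (1 ≤ r ∧ Even (k + r) ∧ Even k ∧ 2 ≤ l)) →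
      (FMP.minSize n k : ℚ) = (n : ℚ) * k / 2) ∧
    ((1 ≤ r ∧ Even (k + r) ∧ Odd k ∧ 2 ≤ l) →
      (FMP.minSize n k : ℚ) = ((n : ℚ) * k + 1) / 2) ∧
    ((1 ≤ r ∧ Even (k + r) ∧ l = 1 ∧ k + 2 ≤ n) →
      ⌈(n : ℚ) * k / 2⌉ ≤ (FMP.minSize n k : ℤ) ∧
      (FMP.minSize n k : ℚ) ≤ ((n : ℚ) - 1) * ((k : ℚ) + 2) / 2) := by
  have hl : 1 ≤ l := by
    by_contra! h
    obtain rfl : l = 0 := by omega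
    omega
  have hl2 : 2 ≤ l → 2 * k + 2 + r ≤ n := fun h => by nlinarith
  have hl1 : l = 1 → n = k + 1 + r := fun h => by rw [hn, h]; omega
  have hpar : Odd n → Even k → (Odd l ↔ Even r) := by
    intro h1 h2
    rw [hn] at h1
    grind
  have hparodd : Odd n → Odd k → Odd r := by
    intro h1 h2
    rw [hn] at h1
    grind
  refine ⟨?_, ?_, ?_, ?_⟩
  · obtain h | h := Nat.even_or_odd n
    · obtain ⟨m, hm, -⟩ := FMP.exists_mem_sizes_of_even h (by omega : k < n)
      exact ⟨m, hm⟩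
    · obtain rfl | h' := hkn.eq_or_lt
      · obtain ⟨m, hm, -⟩ := FMP.exists_mem_sizes_succ hk
        exact ⟨m, hm⟩
      · obtain ⟨m, hm, -⟩ := FMP.exists_mem_sizes_of_odd h h'
        exact ⟨m, hm⟩
  · intro h
    obtain ⟨m, hm, hle⟩ : ∃ m ∈ FMP.sizes n k, 2 * m ≤ n * k := by
      obtain h' | h' := Nat.even_or_odd n
      · exact FMP.exists_mem_sizes_of_even h' (by omega)
      · have hke : Even k := by
          by_contra hko
          rw [Nat.not_even_iff_odd] at hko
          have := hparodd h' hko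
          grind
        refine FMP.exists_mem_sizes_of_odd_of_even hk h' hke ?_
        have := hpar h' hke
        obtain hl' | hl' := hl.eq_or_lt
        -- Here `l = 1` makes `r` even, so only `r = 0` survives, that is `n = k + 1`.
        · subst hl'
          grind
        · have := hl2 hl'
          omega
    obtain ⟨h1, h2⟩ := FMP.minSize_bounds hm hle
    have h3 : ((2 * FMP.minSize n k : ℕ) : ℚ) = (n * k : ℕ) := by rw [le_antisymm h2 h1]
    push_cast at h3
    linarith
  · rintro ⟨hr1, hkr, hko, hl'⟩
    have hro : Odd r := by grind
    have hno : Odd n := by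
      rw [hn]
      grind
    have := hl2 hl'
    obtain ⟨m, hm, hle⟩ := FMP.exists_mem_sizes_of_odd_of_odd hk hno hko (by omega)
    obtain ⟨h1, h2⟩ := FMP.minSize_bounds hm hle
    -- `n * k` is odd, so the even number `2 * FMP.minSize n k` cannot equal it.
    have h3 : 2 * FMP.minSize n k = n * k + 1 := by
      obtain ⟨i, hi⟩ := hno.mul hko
      omega
    have h4 : ((2 * FMP.minSize n k : ℕ) : ℚ) = (n * k + 1 : ℕ) := by rw [h3]
    push_cast at h4
    linarith
  · rintro ⟨hr1, hkr, hl', hkn'⟩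
    have hno : Odd n := by
      rw [hl1 hl']
      grind
    obtain ⟨m, hm, hle⟩ := FMP.exists_mem_sizes_of_odd hno hkn'
    obtain ⟨h1, h2⟩ := FMP.minSize_bounds hm hle
    constructor
    · rw [Int.ceil_le]
      have h3 : ((n * k : ℕ) : ℚ) ≤ (2 * FMP.minSize n k : ℕ) := by exact_mod_cast h1
      push_cast at h3 ⊢
      linarith
    · have h3 : ((2 * FMP.minSize n k : ℕ) : ℚ) ≤ ((n - 1) * (k + 2) : ℕ) := by exact_mod_cast h2
      rw [Nat.cast_mul (n - 1), Nat.cast_sub (by omega : 1 ≤ n)] at h3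
      push_cast at h3
      linarith
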